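/- Let $F$ be a probability distribution of $(x,y)\in\mathcal X\times\mathbb R$, let $\{\widehat m(\cdot,b):b\in\Lambda\}$ be the models under consideration, indexed by a metric space $\Lambda$, and let $\mathrm{Loss}\ge 0$ be a loss function such that the risk $\mathcal R(b)=\int \mathrm{Loss}(y,\widehat m(x,b))\,dF(x,y)$ is finite for every $b\in\Lambda$. For a sample $(x_i,y_i)_{i\le n}$ let $\mathcal R_n(b)=\frac1n\sum_{i=1}^n\mathrm{Loss}(y_i,\widehat m(x_i,b))$ be the empirical risk, and put $\mathcal R_{\min}=\inf_{b\in\Lambda}\mathcal R(b)$. Let $\Lambda=\bigcup_k S_k$ be an admissible structure: each class $S_k$ has finite VC dimension $h_k$, the largest number of points $(x,c)\in\mathcal X\times\mathbb R$ that are shattered by the subgraphs $\{(x,c):c<\widehat m(x,b)\}$, $b\in S_k$. Suppose that $\sup_{b\in\Lambda}|\mathcal R_n(b)-\mathcal R(b)|\to0$ in probability as $n\to\infty$, for i.i.d. samples of size $n$ from $F$. Let a training set of size $n_t$ and a test set of size $n_s$ be given, each of them i.i.d. from $F$, and let $\widetilde n=\min\{n_s,n_t\}$. Let $b_{test}\in\operatorname{argmin}_{b\in\Lambda}\mathcal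 R_{n_s}(b)$ be an empirical generalization-error minimizer, where $\mathcal R_{n_s}$ is the empirical risk on the test set. Let $b_{SRM}\in S_{\hat k}$ be a structural risk minimizer: with $\mathcal R_{n_t}$ the empirical risk on the training set, the pair $(\hat k,b_{SRM})$ minimizes the upper bound $$\overline M_k(b)=\frac{\mathcal R_{n_t}(b)}{1-\sqrt{\epsilon_k}},\qquad \epsilon_k=\frac1{n_t}\Big[h_k\ln\frac{n_t}{h_k}+h_k-\ln\eta\Big],\quad \eta=\frac1{n_t}$$ (with $h\ln(n/h)=0$ for $h=0$) over all $k$ with $h_k\le n_t$ and $\epsilon_k<1$ and all $b\in S_k$. Assume that, for all sufficiently large $\widetilde n$, both minimizers exist almost surely. Then, as $\widetilde n\to\infty$, the empirical generalization-error minimizer and the structural risk minimizer converge to the same limit, in the following sense. 1. The minimal empirical generalization error $\mathcal R_{n_s}(b_{test})$, the minimal upper bound $\overline M_{\hat k}(b_{SRM})$ and the training error $\mathcal R_{n_t}(b_{SRM})$ all converge in probability to $\mathcal R_{\min}$. 2. The true generalization errors $\mathcal R(b_{test})$ and $\mathcal R(b_{SRM})$ both converge in probability to $\mathcal R_{\min}$.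 3. If $b_0\in\Lambda$ is a well-separated minimizer of the risk, that is, $\mathcal R(b_0)=\mathcal R_{\min}$ and $\inf_{b\notin U}\mathcal R(b)>\mathcal R(b_0)$ for every neighbourhood $U\ne\Lambda$ of $b_0$, then $b_{test}\to b_0$ and $b_{SRM}\to b_0$ in probability. -/

import Mathlib

open MeasureTheory ProbabilityTheory Filter Topology

noncomputable section

namespace SRM

variable {𝒳 Λ ι Ω : Type*}

/-- The loss incurred by the model `b` at the data point `z = (x, y)`: `Loss (y, m (x, b))`. -/
def pointLoss (Loss : ℝ → ℝ → ℝ) (m : 𝒳 → Λ → ℝ) (b : Λ) (z : 𝒳 × ℝ) : ℝ :=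
  Loss z.2 (m z.1 b)

/-- The risk functional `R(b) = ∫ Loss (y, m (x, b)) dF(x, y)`. -/
def risk [MeasurableSpace 𝒳] (F : Measure (𝒳 × ℝ)) (Loss : ℝ → ℝ → ℝ) (m : 𝒳 → Λ → ℝ)
    (b : Λ) : ℝ :=
  ∫ z, pointLoss Loss m b z ∂F

/-- The empirical risk `R_n(b) = (1/n) ∑ Loss (y_i, m (x_i, b))` on a sample of size `n`. -/
def empRisk (Loss : ℝ → ℝ → ℝ) (m : 𝒳 → Λ → ℝ) {n : ℕ} (s : Fin n → 𝒳 × ℝ) (b : Λ) : ℝ :=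
  (1 / (n : ℝ)) * ∑ i, pointLoss Loss m b (s i)

/-- The smallest generalization error in the population, `R_min = inf_{b ∈ Λ} R(b)`. -/
def minRisk [MeasurableSpace 𝒳] (F : Measure (𝒳 × ℝ)) (Loss : ℝ → ℝ → ℝ)
    (m : 𝒳 → Λ → ℝ) : ℝ :=
  ⨅ b, risk F Loss m b

/-- A random sample of size `n`, drawn i.i.d. from the population `F`. -/
structure IsIIDSample [MeasurableSpace 𝒳] [MeasurableSpace Ω] (P : Measure Ω)
    (F : Measure (𝒳 × ℝ)) {n : ℕ} (s : Ω → Fin n → 𝒳 × ℝ) : Prop where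
  measurable : ∀ i, Measurable fun ω => s ω i
  indep : iIndepFun (fun (i : Fin n) (ω : Ω) => s ω i) P
  law : ∀ i, P.map (fun ω => s ω i) = F

/-- `sup_{b ∈ Λ} |R_n(b) - R(b)| → 0` in probability as `n → ∞`, for i.i.d. samples of size `n`
from `F`. The supremum is taken in `[0, ∞]`; where it is not measurable, the probability is
the outer one. -/
def UniformConvergence [MeasurableSpace 𝒳] (F : Measure (𝒳 × ℝ)) [SigmaFinite F]
    (Loss : ℝ → ℝ → ℝ) (m : 𝒳 → Λ → ℝ) : Prop :=
  ∀ δ : ℝ, 0 < δ →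
    Tendsto (fun n : ℕ => Measure.pi (fun _ : Fin n => F)
      {s | ENNReal.ofReal δ ≤ ⨆ b, ENNReal.ofReal |empRisk Loss m s b - risk F Loss m b|})
      atTop (𝓝 0)

/-- The class of regression functions `m (·, b)`, `b ∈ S`, shatters the finite set `A` of points
`(x, c)`: every subset of `A` is cut out of `A` by the subgraph `{(x, c) | c < m (x, b)}` of some
member of the class. -/
def Shatters (m : 𝒳 → Λ → ℝ) (S : Set Λ) (A : Finset (𝒳 × ℝ)) : Prop :=
  ∀ B ⊆ A, ∃ b ∈ S, ∀ q ∈ A, q.2 < m q.1 b ↔ q ∈ B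

/-- The Vapnik-Chervonenkis dimension of the class of regression functions `m (·, b)`, `b ∈ S`:
the largest cardinality of a shattered set (the value `⊤` is possible). -/
def vcDim (m : 𝒳 → Λ → ℝ) (S : Set Λ) : ℕ∞ :=
  ⨆ (A : Finset (𝒳 × ℝ)) (_ : Shatters m S A), (A.card : ℕ∞)

/-- `ε = (1/n) [h ln (n/h) + h - ln η]`. -/
def vcEps (n h : ℕ) (η : ℝ) : ℝ :=
  (1 / (n : ℝ)) * ((h : ℝ) * Real.log ((n : ℝ) / (h : ℝ)) + (h : ℝ) - Real.log η)

/-- The value of `ε` for the class `S` and a sample of size `n`, at confidence level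
`1 - η = 1 - 1/n`. -/
def eps (m : 𝒳 → Λ → ℝ) (S : Set Λ) (n : ℕ) : ℝ :=
  vcEps n (vcDim m S).toNat (1 / (n : ℝ))

/-- The upper bound `R_n(b) / (1 - √ε)` of the generalization error, for `b` in the class `S`. -/
def vcBound (Loss : ℝ → ℝ → ℝ) (m : 𝒳 → Λ → ℝ) (S : Set Λ) {n : ℕ} (s : Fin n → 𝒳 × ℝ)
    (b : Λ) : ℝ :=
  empRisk Loss m s b / (1 - √(eps m S n))

/-- The bound is meaningful for the class `S` and the sample size `n`: the Vapnik-Chervonenkis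
dimension is at most `n`, and `ε < 1`. Otherwise there is no upper bound to be minimized. -/
def BoundValid (m : 𝒳 → Λ → ℝ) (S : Set Λ) (n : ℕ) : Prop :=
  vcDim m S ≤ (n : ℕ∞) ∧ eps m S n < 1

/-- An admissible structure on the space `Λ` of alternative models: classes of finite
Vapnik-Chervonenkis dimension that together exhaust `Λ`. -/
def IsAdmissibleStructure (m : 𝒳 → Λ → ℝ) (S : ι → Set Λ) : Prop :=
  (⋃ k, S k) = Set.univ ∧ ∀ k, vcDim m (S k) < ⊤

/-- `b` minimizes the empirical generalization error, the empirical risk on the test set `s`. -/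
def IsEmpGEMinimizer (Loss : ℝ → ℝ → ℝ) (m : 𝒳 → Λ → ℝ) {n : ℕ} (s : Fin n → 𝒳 × ℝ)
    (b : Λ) : Prop :=
  ∀ b', empRisk Loss m s b ≤ empRisk Loss m s b'

/-- `b`, chosen in the class `S k`, is a structural risk minimizer on the training set `t`: the
pair `(k, b)` minimizes the upper bound of the generalization error over all the classes for
which there is one and over all the models in them. -/
def IsStructuralRiskMinimizer (Loss : ℝ → ℝ → ℝ) (m : 𝒳 → Λ → ℝ) (S : ι → Set Λ) {n : ℕ}
    (t : Fin n → 𝒳 × ℝ) (k : ι) (b : Λ) : Prop :=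
  BoundValid m (S k) n ∧ b ∈ S k ∧
    ∀ k', BoundValid m (S k') n → ∀ b' ∈ S k',
      vcBound Loss m (S k) t b ≤ vcBound Loss m (S k') t b'

/-- `b₀` is the well-separated (identified) minimizer of the risk: outside every neighbourhood of
`b₀` the risk exceeds `R(b₀)` by some positive amount. -/
def IsWellSeparatedMinimizer [MeasurableSpace 𝒳] [TopologicalSpace Λ] (F : Measure (𝒳 × ℝ))
    (Loss : ℝ → ℝ → ℝ) (m : 𝒳 → Λ → ℝ) (b₀ : Λ) : Prop :=
  (∀ b, risk F Loss m b₀ ≤ risk F Loss m b) ∧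
    ∀ U ∈ 𝓝 b₀, ∃ δ > 0, ∀ b ∉ U, risk F Loss m b₀ + δ ≤ risk F Loss m b

end SRM

end

/-! Probability enters only through the event that the empirical risk is within δ of the risk
uniformly over `Λ`, whose complement has vanishing outer probability; on it all the estimates are
deterministic. For the test minimizer, R - δ < R_n ≤ R_min + δ. For structural minimization, fix a
model b' with risk below R_min + δ and a class containing it. That class does not vary with n, so
its ε tends to 0 and its bound at b' eventually falls below R_min + 2δ (`eventually_vcBound_lt`).
The minimal bound is no larger, whichever class is selected, and it dominates the training error,
which exceeds R_min - δ. Hence no control on the dimension of the selected class is needed. -/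

namespace SRM

section Deviation

variable {𝒳 Λ Ω : Type*} [MeasurableSpace 𝒳] [MeasurableSpace Ω]

/-- The empirical risk on the sample `s` is within `δ` of the risk, uniformly over the models. -/
def UniformlyClose (F : Measure (𝒳 × ℝ)) (Loss : ℝ → ℝ → ℝ) (m : 𝒳 → Λ → ℝ) {n : ℕ} (δ : ℝ)
    (s : Fin n → 𝒳 × ℝ) : Prop :=
  ∀ b, |empRisk Loss m s b - risk F Loss m b| < δ

theorem IsIIDSample.map_eq_pi {P : Measure Ω} {F : Measure (𝒳 × ℝ)} [IsProbabilityMeasure P]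
    {n : ℕ} {s : Ω → Fin n → 𝒳 × ℝ} (hs : IsIIDSample P F s) :
    P.map s = Measure.pi fun _ => F := by
  have h := (iIndepFun_iff_map_fun_eq_pi_map fun i => (hs.measurable i).aemeasurable).1 hs.indep
  simpa only [hs.law] using h

theorem tendsto_measure_not_uniformlyClose {P : Measure Ω} [IsProbabilityMeasure P]
    {F : Measure (𝒳 × ℝ)} [IsProbabilityMeasure F] {Loss : ℝ → ℝ → ℝ} {m : 𝒳 → Λ → ℝ}
    (hunif : UniformConvergence F Loss m) {n : ℕ → ℕ} (hn : Tendsto n atTop atTop)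
    {s : (j : ℕ) → Ω → Fin (n j) → 𝒳 × ℝ} (hs : ∀ j, IsIIDSample P F (s j))
    {δ : ℝ} (hδ : 0 < δ) :
    Tendsto (fun j => P {ω | ¬ UniformlyClose F Loss m δ (s j ω)}) atTop (𝓝 0) := by
  refine tendsto_of_tendsto_of_tendsto_of_le_of_le tendsto_const_nhds ((hunif δ hδ).comp hn)
    (fun _ => zero_le) fun j => ?_
  have hmeas : Measurable (s j) := measurable_pi_lambda _ (hs j).measurable
  simp only [Function.comp_apply]
  rw [← (hs j).map_eq_pi]
  -- The deviation event may be non-measurable; P(s⁻¹ A) ≤ (P.map s) A holds for every set A.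
  refine le_trans (measure_mono ?_) (Measure.le_map_apply hmeas.aemeasurable _)
  intro ω hω
  simp only [UniformlyClose, Set.mem_ofPred_eq, not_forall, not_lt] at hω
  obtain ⟨b, hb⟩ := hω
  exact (ENNReal.ofReal_le_ofReal hb).trans
    (le_iSup (fun b => ENNReal.ofReal |empRisk Loss m (s j ω) b - risk F Loss m b|) b)

/-- Up to a null set, a deviation of `f j` by ε forces the sample out of the uniformly close event,
so no measurability of `f j` is required. -/
theorem tendstoInMeasure_of_uniformlyClose {P : Measure Ω} [IsProbabilityMeasure P]
    {F : Measure (𝒳 × ℝ)} [IsProbabilityMeasure F] {Loss : ℝ → ℝ → ℝ} {m : 𝒳 → Λ → ℝ}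
    (hunif : UniformConvergence F Loss m) {n : ℕ → ℕ} (hn : Tendsto n atTop atTop)
    {s : (j : ℕ) → Ω → Fin (n j) → 𝒳 × ℝ} (hs : ∀ j, IsIIDSample P F (s j))
    {f : ℕ → Ω → ℝ} {c : ℝ}
    (h : ∀ ε > 0, ∃ δ > 0, ∀ᶠ j in atTop, ∀ᵐ ω ∂P,
      UniformlyClose F Loss m δ (s j ω) → |f j ω - c| < ε) :
    TendstoInMeasure P f atTop fun _ => c := by
  rw [tendstoInMeasure_iff_dist]
  intro ε hε
  obtain ⟨δ, hδ, hev⟩ := h ε hε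
  refine tendsto_of_tendsto_of_tendsto_of_le_of_le' tendsto_const_nhds
    (tendsto_measure_not_uniformlyClose hunif hn hs hδ)
    (Eventually.of_forall fun _ => zero_le) ?_
  filter_upwards [hev] with j hj
  refine measure_mono_ae ?_
  filter_upwards [hj] with ω hω (hdist : ε ≤ dist (f j ω) c) hclose
  exact absurd (hω hclose) (not_lt.2 hdist)

end Deviation

section Risk

variable {𝒳 Λ Ω : Type*} [MeasurableSpace 𝒳] {F : Measure (𝒳 × ℝ)} {Loss : ℝ → ℝ → ℝ}
  {m : 𝒳 → Λ → ℝ}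

theorem minRisk_le (hLoss : ∀ y v, 0 ≤ Loss y v) (b : Λ) : minRisk F Loss m ≤ risk F Loss m b :=
  ciInf_le ⟨0, by rintro _ ⟨b, rfl⟩; exact integral_nonneg fun z => hLoss _ _⟩ b

theorem IsWellSeparatedMinimizer.minRisk_eq [TopologicalSpace Λ] {b₀ : Λ}
    (hLoss : ∀ y v, 0 ≤ Loss y v) (h : IsWellSeparatedMinimizer F Loss m b₀) :
    minRisk F Loss m = risk F Loss m b₀ :=
  have : Nonempty Λ := ⟨b₀⟩
  le_antisymm (minRisk_le hLoss b₀) (le_ciInf h.1)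

/-- Leaving the ε-ball around `b₀` costs a fixed excess risk δ, so that event is contained in a
deviation event of the risks. -/
theorem IsWellSeparatedMinimizer.tendstoInMeasure [MeasurableSpace Ω] {P : Measure Ω}
    [MetricSpace Λ] {b₀ : Λ} (hLoss : ∀ y v, 0 ≤ Loss y v)
    (h : IsWellSeparatedMinimizer F Loss m b₀) {b : ℕ → Ω → Λ}
    (hb : TendstoInMeasure P (fun j ω => risk F Loss m (b j ω)) atTop
      fun _ => minRisk F Loss m) :
    TendstoInMeasure P b atTop fun _ => b₀ := by
  rw [tendstoInMeasure_iff_dist] at hb ⊢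
  intro ε hε
  obtain ⟨δ, hδ, hsep⟩ := h.2 _ (Metric.ball_mem_nhds b₀ hε)
  refine tendsto_of_tendsto_of_tendsto_of_le_of_le tendsto_const_nhds (hb δ hδ)
    (fun _ => zero_le) fun j => measure_mono fun ω (hω : ε ≤ dist (b j ω) b₀) => ?_
  have hr := hsep (b j ω) fun hmem => absurd (Metric.mem_ball.1 hmem) (not_lt.2 hω)
  rw [Set.mem_ofPred_eq, Real.dist_eq, h.minRisk_eq hLoss]
  exact le_trans (by linarith) (le_abs_self _)

theorem IsEmpGEMinimizer.empRisk_le {n : ℕ} {s : Fin n → 𝒳 × ℝ} {b : Λ} {δ : ℝ}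
    (hb : IsEmpGEMinimizer Loss m s b) (hs : UniformlyClose F Loss m δ s) :
    empRisk Loss m s b ≤ minRisk F Loss m + δ := by
  have : Nonempty Λ := ⟨b⟩
  have : empRisk Loss m s b - δ ≤ minRisk F Loss m := le_ciInf fun b' => by
    have h1 := hb b'
    have h2 := (abs_lt.1 (hs b')).2
    linarith
  linarith

end Risk

theorem empRisk_nonneg {𝒳 Λ : Type*} {Loss : ℝ → ℝ → ℝ} {m : 𝒳 → Λ → ℝ}
    (hLoss : ∀ y v, 0 ≤ Loss y v) {n : ℕ} (s : Fin n → 𝒳 × ℝ) (b : Λ) :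
    0 ≤ empRisk Loss m s b :=
  mul_nonneg (by positivity) (Finset.sum_nonneg fun _ _ => hLoss _ _)

/-- The nonnegative empirical risk is divided by a number in (0, 1]. -/
theorem empRisk_le_vcBound {𝒳 Λ : Type*} {Loss : ℝ → ℝ → ℝ} {m : 𝒳 → Λ → ℝ}
    (hLoss : ∀ y v, 0 ≤ Loss y v) {S : Set Λ} {n : ℕ}
    (hS : BoundValid m S n) (s : Fin n → 𝒳 × ℝ) (b : Λ) :
    empRisk Loss m s b ≤ vcBound Loss m S s b := by
  have h : √(eps m S n) < 1 := (Real.sqrt_lt' one_pos).2 (by simpa using hS.2)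
  exact le_div_self (empRisk_nonneg hLoss s b) (by linarith) (by simp)

section Capacity

variable {𝒳 Λ ι : Type*}

/-- Since -ln(1/n) = ln n, for h > 0 the quantity equals ((h + 1) ln n + h - h ln h)/n. -/
theorem tendsto_vcEps (h : ℕ) : Tendsto (fun n : ℕ => vcEps n h (1 / (n : ℝ))) atTop (𝓝 0) := by
  have hlog : Tendsto (fun n : ℕ => Real.log n / n) atTop (𝓝 0) :=
    Real.isLittleO_log_id_atTop.tendsto_div_nhds_zero.comp tendsto_natCast_atTop_atTop
  have hc (c : ℝ) : Tendsto (fun n : ℕ => c / (n : ℝ)) atTop (𝓝 0) :=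
    tendsto_const_div_atTop_nhds_zero_nat c
  have key := (hlog.const_mul ((h : ℝ) + 1)).add (hc (h - h * Real.log h))
  rw [mul_zero, add_zero] at key
  refine key.congr' ?_
  filter_upwards [eventually_gt_atTop 0] with n hn
  have hn' : (n : ℝ) ≠ 0 := by positivity
  -- For h = 0 the logarithm of the quotient cannot be split, but its coefficient vanishes.
  rcases Nat.eq_zero_or_pos h with rfl | hh
  · simp [vcEps, div_eq_inv_mul]
  · have hh' : (h : ℝ) ≠ 0 := by positivity
    rw [vcEps, Real.log_div hn' hh', one_div, Real.log_inv]
    field_simp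
    ring

theorem eventually_boundValid {m : 𝒳 → Λ → ℝ} {S : Set Λ} (hS : vcDim m S < ⊤) :
    ∀ᶠ n in atTop, BoundValid m S n := by
  filter_upwards [(tendsto_vcEps (vcDim m S).toNat).eventually_lt_const one_pos,
    eventually_ge_atTop (vcDim m S).toNat] with n hε hn
  refine ⟨?_, hε⟩
  rw [← ENat.natCast_toNat hS.ne]
  exact_mod_cast hn

theorem tendsto_div_one_sub_sqrt_eps (m : 𝒳 → Λ → ℝ) (S : Set Λ) (r : ℝ) :
    Tendsto (fun n => r / (1 - √(eps m S n))) atTop (𝓝 r) := by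
  have h : Tendsto (fun n => √(eps m S n)) atTop (𝓝 0) := by
    simpa only [eps, Real.sqrt_zero] using (tendsto_vcEps (vcDim m S).toNat).sqrt
  have hdiv := Tendsto.div (tendsto_const_nhds (x := r)) (h.const_sub 1) (by simp)
  rwa [sub_zero, div_one] at hdiv

/-- For large samples close to the population, the minimal upper bound is at most slightly larger
than the minimal risk. -/
theorem eventually_vcBound_lt [MeasurableSpace 𝒳] [Nonempty Λ] {F : Measure (𝒳 × ℝ)}
    {Loss : ℝ → ℝ → ℝ} {m : 𝒳 → Λ → ℝ} {S : ι → Set Λ}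
    (hS : IsAdmissibleStructure m S) {δ : ℝ} (hδ : 0 < δ) :
    ∀ᶠ n : ℕ in atTop, ∀ (s : Fin n → 𝒳 × ℝ) (k : ι) (b : Λ),
      IsStructuralRiskMinimizer Loss m S s k b → UniformlyClose F Loss m δ s →
        vcBound Loss m (S k) s b < minRisk F Loss m + 2 * δ := by
  -- The infimum need not be attained, so b' is only near-optimal; it is chosen before n and the
  -- sample.
  obtain ⟨b', hb'⟩ : ∃ b', risk F Loss m b' < minRisk F Loss m + δ :=
    exists_lt_of_ciInf_lt (lt_add_of_pos_right _ hδ)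
  obtain ⟨k', hk'⟩ : ∃ k', b' ∈ S k' := Set.mem_iUnion.1 (hS.1 ▸ Set.mem_univ b')
  have hlim := tendsto_div_one_sub_sqrt_eps m (S k') (risk F Loss m b' + δ)
  filter_upwards [eventually_boundValid (hS.2 k'),
    hlim.eventually_lt_const (show _ < minRisk F Loss m + 2 * δ by linarith)]
    with n hvalid hlt s k b hb hs
  have hpos : √(eps m (S k') n) < 1 := (Real.sqrt_lt' one_pos).2 (by simpa using hvalid.2)
  refine ((hb.2.2 k' hvalid b' hk').trans ?_).trans_lt hlt
  refine div_le_div_of_nonneg_right ?_ (by linarith)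
  linarith [(abs_lt.1 (hs b')).2]

end Capacity

end SRM

theorem corollary1 {𝒳 Λ ι Ω : Type*} [MeasurableSpace 𝒳] [MetricSpace Λ] [MeasurableSpace Ω]
    (P : Measure Ω) [IsProbabilityMeasure P]
    -- the population, the loss, the functional form, and the admissible structure
    (F : Measure (𝒳 × ℝ)) [IsProbabilityMeasure F]
    (Loss : ℝ → ℝ → ℝ) (hLoss : ∀ y v, 0 ≤ Loss y v)
    (m : 𝒳 → Λ → ℝ)
    (hint : ∀ b, Integrable (SRM.pointLoss Loss m b) F)
    (S : ι → Set Λ) (hS : SRM.IsAdmissibleStructure m S)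
    (hunif : SRM.UniformConvergence F Loss m)
    -- training and test sets, whose sizes satisfy `min (n_t, n_s) → ∞`
    (nt ns : ℕ → ℕ) (hn : Tendsto (fun j => min (ns j) (nt j)) atTop atTop)
    (train : (j : ℕ) → Ω → Fin (nt j) → 𝒳 × ℝ) (htrain : ∀ j, SRM.IsIIDSample P F (train j))
    (test : (j : ℕ) → Ω → Fin (ns j) → 𝒳 × ℝ) (htest : ∀ j, SRM.IsIIDSample P F (test j))
    -- the empirical GE minimizer
    (bTest : ℕ → Ω → Λ)
    (hbTest : ∀ᶠ j in atTop, ∀ᵐ ω ∂P, SRM.IsEmpGEMinimizer Loss m (test j ω) (bTest j ω))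
    -- the structural risk minimizer, and the class in which it lies
    (kSRM : ℕ → Ω → ι) (bSRM : ℕ → Ω → Λ)
    (hbSRM : ∀ᶠ j in atTop, ∀ᵐ ω ∂P,
      SRM.IsStructuralRiskMinimizer Loss m S (train j ω) (kSRM j ω) (bSRM j ω)) :
    -- the minimal empirical GE and the minimal structural risk have the limit `R_min`
    TendstoInMeasure P (fun j ω => SRM.empRisk Loss m (test j ω) (bTest j ω)) atTop
      (fun _ => SRM.minRisk F Loss m) ∧
    TendstoInMeasure P
      (fun j ω => SRM.vcBound Loss m (S (kSRM j ω)) (train j ω) (bSRM j ω)) atTop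
      (fun _ => SRM.minRisk F Loss m) ∧
    TendstoInMeasure P (fun j ω => SRM.empRisk Loss m (train j ω) (bSRM j ω)) atTop
      (fun _ => SRM.minRisk F Loss m) ∧
    -- so have the true generalization errors of the two minimizers
    TendstoInMeasure P (fun j ω => SRM.risk F Loss m (bTest j ω)) atTop
      (fun _ => SRM.minRisk F Loss m) ∧
    TendstoInMeasure P (fun j ω => SRM.risk F Loss m (bSRM j ω)) atTop
      (fun _ => SRM.minRisk F Loss m) ∧
    -- and the minimizers themselves have the same limit, wherever that limit is identified
    ∀ b₀, SRM.IsWellSeparatedMinimizer F Loss m b₀ →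
      TendstoInMeasure P bTest atTop (fun _ => b₀) ∧
      TendstoInMeasure P bSRM atTop (fun _ => b₀) := by
  have : Nonempty Λ := (nonempty_of_isProbabilityMeasure P).map (bTest 0)
  have hns : Tendsto ns atTop atTop := tendsto_atTop_mono (fun _ => min_le_left _ _) hn
  have hnt : Tendsto nt atTop atTop := tendsto_atTop_mono (fun _ => min_le_right _ _) hn
  have hmin := SRM.minRisk_le (F := F) (m := m) hLoss
  have hRiskTest : TendstoInMeasure P (fun j ω => SRM.risk F Loss m (bTest j ω)) atTop
      (fun _ => SRM.minRisk F Loss m) := by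
    refine SRM.tendstoInMeasure_of_uniformlyClose hunif hns htest fun ε hε =>
      ⟨ε / 4, by positivity, ?_⟩
    filter_upwards [hbTest] with j hj
    filter_upwards [hj] with ω hω hs
    have h1 := hω.empRisk_le hs
    have h2 := abs_lt.1 (hs (bTest j ω))
    have h3 := hmin (bTest j ω)
    exact abs_lt.2 ⟨by linarith, by linarith⟩
  have hsandwich : ∀ ε > 0, ∃ δ > 0, ∀ᶠ j in atTop, ∀ᵐ ω ∂P,
      SRM.UniformlyClose F Loss m δ (train j ω) →
        |SRM.vcBound Loss m (S (kSRM j ω)) (train j ω) (bSRM j ω) - SRM.minRisk F Loss m| < ε ∧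
        |SRM.empRisk Loss m (train j ω) (bSRM j ω) - SRM.minRisk F Loss m| < ε ∧
        |SRM.risk F Loss m (bSRM j ω) - SRM.minRisk F Loss m| < ε := by
    intro ε hε
    have hδ : 0 < ε / 4 := by positivity
    -- With δ = ε/4 the chain R - δ < R_n ≤ bound < R_min + 2δ leaves all three quantities between
    -- R_min - δ and R_min + 3δ.
    refine ⟨ε / 4, hδ, ?_⟩
    filter_upwards [hbSRM, hnt.eventually (SRM.eventually_vcBound_lt (F := F) (Loss := Loss) hS hδ)]
      with j hj hbound
    filter_upwards [hj] with ω hω hs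
    have h1 := hbound _ _ _ hω hs
    have h2 := abs_lt.1 (hs (bSRM j ω))
    have h3 := hmin (bSRM j ω)
    have h4 := SRM.empRisk_le_vcBound hLoss hω.1 (train j ω) (bSRM j ω)
    refine ⟨abs_lt.2 ⟨?_, ?_⟩, abs_lt.2 ⟨?_, ?_⟩, abs_lt.2 ⟨?_, ?_⟩⟩ <;> linarith
  have hRiskSRM : TendstoInMeasure P (fun j ω => SRM.risk F Loss m (bSRM j ω)) atTop
      (fun _ => SRM.minRisk F Loss m) := by
    refine SRM.tendstoInMeasure_of_uniformlyClose hunif hnt htrain fun ε hε => ?_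
    obtain ⟨δ, hδ, h⟩ := hsandwich ε hε
    exact ⟨δ, hδ, h.mono fun j hj => hj.mono fun ω hω hs => (hω hs).2.2⟩
  refine ⟨?_, ?_, ?_, hRiskTest, hRiskSRM, fun b₀ hb₀ =>
    ⟨hb₀.tendstoInMeasure hLoss hRiskTest, hb₀.tendstoInMeasure hLoss hRiskSRM⟩⟩
  · refine SRM.tendstoInMeasure_of_uniformlyClose hunif hns htest fun ε hε =>
      ⟨ε / 4, by positivity, ?_⟩
    filter_upwards [hbTest] with j hj
    filter_upwards [hj] with ω hω hs
    have h1 := hω.empRisk_le hs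
    have h2 := abs_lt.1 (hs (bTest j ω))
    have h3 := hmin (bTest j ω)
    exact abs_lt.2 ⟨by linarith, by linarith⟩
  · refine SRM.tendstoInMeasure_of_uniformlyClose hunif hnt htrain fun ε hε => ?_
    obtain ⟨δ, hδ, h⟩ := hsandwich ε hε
    exact ⟨δ, hδ, h.mono fun j hj => hj.mono fun ω hω hs => (hω hs).1⟩
  · refine SRM.tendstoInMeasure_of_uniformlyClose hunif hnt htrain fun ε hε => ?_
    obtain ⟨δ, hδ, h⟩ := hsandwich ε hε
    exact ⟨δ, hδ, h.mono fun j hj => hj.mono fun ω hω hs => (hω hs).2.1⟩
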